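/- Let $K$ be a nonarchimedean local field with valuation $\operatorname{ord}$, valuation ring $\mathcal O$, uniformizer $\varpi$, and residue characteristic $\neq 2$. Let $|\cdot|$ be the absolute value of $K$, let $du$ be the Haar measure on $K$ giving $\mathcal O$ mass $1$, and let $dx$ be the product measure on $K^n$. Let $\Psi : (K,+)\to\mathbb C^\times$ be a character that is trivial on $\varpi\mathcal O$ and nontrivial on $\mathcal O$. Let $n$ be a nonnegative integer, let $\Omega\subset\mathcal O^n$ be open, and let $f:\Omega\to\mathcal O$ be globally analytic, i.e. given on $\Omega$ by a single power series in $\mathcal O[[x_1,\dots,x_n]]$ that converges at every point of $\Omega$. Assume that: (i) $f$ has exactly one critical point $x_0$ in $\Omega$ (that is, exactly one $x \in \Omega$ with $\operatorname{grad} f(x) = 0$); (ii) $x_0$ is nondegenerate modulo $\varpi$, i.e. $\det\bigl(\partial^2 f/\partial x_i\partial x_j(x_0)\bigr)\not\equiv 0 \pmod{\varpi}$; (iii) there are a function $R$ with values in the $n\times n$ matrices over $K$ and a real number $M$ such that, for all $x\in\Omega$ and $y\in K^n$ with $x+y\in\Omega$, $$f(x+y)=f(x)+\langle\operatorname{grad}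 f(x),y\rangle+\langle R(x,y)\,y,y\rangle ,\qquad |R(x,y)_{ij}|\le M\quad (1\le i,j\le n),$$ where $\langle\cdot,\cdot\rangle$ is the standard bilinear form on $K^n$. Then there exist an integer $\alpha\ge 1$ and units $a_1,\dots,a_n\in\mathcal O^\times$ such that, for every Schwartz–Bruhat function $\varphi$ on $\Omega$ (i.e. $\varphi:\Omega\to\mathbb C$ locally constant with compact support contained in $\Omega$) with $x_0\in\operatorname{supp}\varphi$, there is an integer $N$ such that, for all $\lambda\in K$ with $\operatorname{ord}\lambda\le N$, $$\int_\Omega\varphi(x)\,\Psi(\lambda f(x))\,dx=\Psi(\lambda f(x_0))\,\varphi(x_0)\prod_{i=1}^n\int_{\varpi^\alpha\mathcal O}\Psi(\lambda a_iu^2)\,du .$$ In particular, $\alpha$ and the $a_i$ do not depend on $\varphi$. -/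

import Mathlib

open MeasureTheory

namespace StationaryPhase

/-! A nonarchimedean local field is a field `K` with a nontrivial ultrametric absolute value for
which it is locally compact. The absolute value is only fixed up to a positive power; every notion
below is insensitive to the replacement of `‖·‖` by `‖·‖ ^ s`. -/

noncomputable section

/-- The valuation ring `𝒪_K = {x | ‖x‖ ≤ 1}`. -/
abbrev integers (K : Type*) [NontriviallyNormedField K] [IsUltrametricDist K] :
    ValuationSubring K :=
  (NormedField.valuation (K := K)).valuationSubring

section Field

variable {K : Type*} [NontriviallyNormedField K] [IsUltrametricDist K]

theorem mem_integers {x : K} : x ∈ integers K ↔ ‖x‖ ≤ 1 := Iff.rfl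

theorem mem_maximalIdeal_iff {x : integers K} :
    x ∈ IsLocalRing.maximalIdeal (integers K) ↔ ‖(x : K)‖ < 1 :=
  (NormedField.valuation (K := K)).mem_maximalIdeal_iff (a := x)

/-- `ϖ` is a uniformizer: it generates the maximal ideal of the valuation ring. -/
def IsUniformizer (ϖ : integers K) : Prop :=
  IsLocalRing.maximalIdeal (integers K) = Ideal.span {ϖ}

open Classical in
/-- The normalized valuation `ord : K → ℤ ∪ {+∞}` attached to a uniformizer `ϖ`: `ord x` is the
integer `k` such that `x` is a unit times `ϖ ^ k`, that is `‖x‖ = ‖ϖ‖ ^ k`, and `ord 0 = +∞`. -/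
def ord (ϖ : integers K) (x : K) : WithTop ℤ :=
  if h : ∃ k : ℤ, ‖x‖ = ‖(ϖ : K)‖ ^ k then ((h.choose : ℤ) : WithTop ℤ) else ⊤

theorem IsUniformizer.norm_pos {ϖ : integers K} (h : IsUniformizer ϖ) : 0 < ‖(ϖ : K)‖ := by
  obtain ⟨x, hx0, hx1⟩ := NormedField.exists_norm_lt_one K
  have hx : (⟨x, hx1.le⟩ : integers K) ∈ IsLocalRing.maximalIdeal (integers K) :=
    mem_maximalIdeal_iff.2 hx1
  rw [h, Ideal.mem_span_singleton] at hx
  obtain ⟨y, hy⟩ := hx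
  rw [norm_pos_iff]
  intro h0
  have : x = (ϖ : K) * (y : K) := congrArg Subtype.val hy
  rw [h0, zero_mul] at this
  simp [this] at hx0

theorem IsUniformizer.norm_lt_one {ϖ : integers K} (h : IsUniformizer ϖ) : ‖(ϖ : K)‖ < 1 := by
  rw [← mem_maximalIdeal_iff, h]
  exact Ideal.mem_span_singleton_self ϖ

theorem ord_zero {ϖ : integers K} (h : IsUniformizer ϖ) : ord ϖ (0 : K) = ⊤ := by
  unfold ord
  rw [dif_neg]
  rintro ⟨k, hk⟩
  rw [norm_zero] at hk
  exact (zpow_pos h.norm_pos k).ne hk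

theorem ord_eq_coe_iff {ϖ : integers K} (h : IsUniformizer ϖ) {x : K} {k : ℤ} :
    ord ϖ x = (k : WithTop ℤ) ↔ ‖x‖ = ‖(ϖ : K)‖ ^ k := by
  unfold ord
  constructor
  · intro hx
    split_ifs at hx with hk
    · rw [← WithTop.coe_inj.1 hx]
      exact hk.choose_spec
    · exact absurd hx (WithTop.coe_ne_top).symm
  · intro hx
    have hk : ∃ k : ℤ, ‖x‖ = ‖(ϖ : K)‖ ^ k := ⟨k, hx⟩
    rw [dif_pos hk, WithTop.coe_inj]
    exact zpow_right_injective₀ h.norm_pos h.norm_lt_one.ne (hk.choose_spec.symm.trans hx)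

theorem ord_ne_top {ϖ : integers K} (h : IsUniformizer ϖ) {x : K} (hx : x ≠ 0) :
    ord ϖ x ≠ ⊤ := by
  obtain ⟨k, hk1, hk2⟩ := exists_mem_Ioc_zpow (norm_pos_iff.2 hx)
    ((one_lt_inv₀ h.norm_pos).2 h.norm_lt_one)
  have hp : (ϖ : K) ≠ 0 := norm_pos_iff.1 h.norm_pos
  suffices hs : ‖x‖ = ‖(ϖ : K)‖ ^ (-(k + 1)) by
    rw [(ord_eq_coe_iff h).2 hs]
    exact WithTop.coe_ne_top
  have hp' := h.norm_pos
  set z : K := x * (ϖ : K) ^ k with hz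
  have hzn : ‖z‖ = ‖x‖ * ‖(ϖ : K)‖ ^ k := by rw [hz, norm_mul, norm_zpow]
  rw [inv_zpow] at hk1 hk2
  have h1 : 1 < ‖z‖ := by
    rw [hzn]
    have := mul_lt_mul_of_pos_right hk1 (zpow_pos hp' k)
    rwa [inv_mul_cancel₀ (zpow_pos hp' k).ne'] at this
  have h2 : ‖z‖ ≤ ‖(ϖ : K)‖⁻¹ := by
    rw [hzn]
    have := mul_le_mul_of_nonneg_right hk2 (zpow_pos hp' k).le
    rwa [zpow_add₀ hp'.ne', zpow_one, mul_inv, mul_right_comm,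
      inv_mul_cancel₀ (zpow_pos hp' k).ne', one_mul] at this
  have h3 : ‖z⁻¹‖ < 1 := by
    rw [norm_inv]
    exact inv_lt_one_of_one_lt₀ h1
  have hm : (⟨z⁻¹, h3.le⟩ : integers K) ∈ IsLocalRing.maximalIdeal (integers K) :=
    mem_maximalIdeal_iff.2 h3
  rw [h, Ideal.mem_span_singleton] at hm
  obtain ⟨y, hy⟩ := hm
  have hy' : z⁻¹ = (ϖ : K) * (y : K) := congrArg Subtype.val hy
  have hy1 : ‖(y : K)‖ ≤ 1 := y.2
  have h4 : ‖z‖⁻¹ ≤ ‖(ϖ : K)‖ := by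
    rw [← norm_inv, hy', norm_mul]
    exact mul_le_of_le_one_right hp'.le hy1
  have h5 : ‖z‖ = ‖(ϖ : K)‖⁻¹ := by
    refine le_antisymm h2 ?_
    have := inv_anti₀ (inv_pos.2 (one_pos.trans h1)) h4
    rwa [inv_inv] at this
  rw [hzn] at h5
  rw [zpow_neg, zpow_add₀ hp'.ne', zpow_one, mul_inv, ← h5]
  field_simp

/-- The ideal `ϖ ^ α 𝒪_K`, as a subset of `K`. -/
def disc (ϖ : integers K) (α : ℕ) : Set K :=
  {u | ∃ z ∈ integers K, u = (ϖ : K) ^ α * z}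

variable {n : ℕ}

/-- `f : Ω → 𝒪_K` is globally analytic: it takes values in `𝒪_K` and is given on `Ω` by one power
series with coefficients in `𝒪_K`, which converges at all points of `Ω`.
(Only the values of `f` on `Ω` matter.) -/
def GloballyAnalyticOn (f : (Fin n → K) → K) (Ω : Set (Fin n → K)) : Prop :=
  (∀ x ∈ Ω, f x ∈ integers K) ∧
    ∃ F : MvPowerSeries (Fin n) (integers K), ∀ x ∈ Ω,
      HasSum (fun d : Fin n →₀ ℕ => ((MvPowerSeries.coeff d F : integers K) : K) * ∏ i, x i ^ d i)
        (f x)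

/-- The partial derivative `∂f/∂x_i`. -/
def partialDeriv (i : Fin n) (f : (Fin n → K) → K) (x : Fin n → K) : K :=
  lineDeriv K f x (Pi.single i 1)

/-- The gradient of `f`. -/
def grad (f : (Fin n → K) → K) (x : Fin n → K) : Fin n → K :=
  fun i => partialDeriv i f x

/-- The Hessian matrix of `f`. -/
def hessian (f : (Fin n → K) → K) (x : Fin n → K) : Matrix (Fin n) (Fin n) K :=
  Matrix.of fun i j => partialDeriv i (partialDeriv j f) x

/-- `x` is a critical point of `f : Ω → 𝒪_K`. -/
def IsCriticalPointOn (f : (Fin n → K) → K) (Ω : Set (Fin n → K)) (x : Fin n → K) : Prop :=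
  x ∈ Ω ∧ grad f x = 0

/-- `x` is nondegenerate modulo `ϖ`: the determinant of the Hessian at `x` is not in `ϖ 𝒪_K`. -/
def IsNondegenerateMod (ϖ : integers K) (f : (Fin n → K) → K) (x : Fin n → K) : Prop :=
  (hessian f x).det ∉ disc ϖ 1

/-- `φ` is a Schwartz-Bruhat function on the open set `Ω`, extended by zero outside `Ω`: it is
locally constant and its support is a compact subset of `Ω`. -/
structure IsSchwartzBruhatOn (φ : (Fin n → K) → ℂ) (Ω : Set (Fin n → K)) : Prop where
  isLocallyConstant : IsLocallyConstant φ
  hasCompactSupport : HasCompactSupport φ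
  tsupport_subset : tsupport φ ⊆ Ω

/-- The oscillatory integral `I_{f, φ}(t) = ∫_Ω φ(x) Ψ(t f(x)) dx`, where `dx` is the product on
`K ^ n` of the measure `μ` on `K`. -/
def oscIntegral [MeasurableSpace K] (μ : Measure K) (Ψ : AddChar K ℂ) (Ω : Set (Fin n → K))
    (f : (Fin n → K) → K) (φ : (Fin n → K) → ℂ) (t : K) : ℂ :=
  ∫ x in Ω, φ x * Ψ (t * f x) ∂(Measure.pi fun _ : Fin n => μ)

end Field

end

end StationaryPhase

open StationaryPhase

/-!
The phase `f` and its quadratic Taylor polynomial at `x₀` localize, for large `t`, to the same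
small ball about `x₀`, on which `Ψ` cannot tell them apart.

* Since `f` is a power series with integral coefficients, its Taylor remainders of order one, two
  and three at points of `Ω` are bounded by `‖y‖`, `‖y‖ ^ 2` and `‖y‖ ^ 3`, and its Hessian is
  symmetric and integral (`GloballyAnalyticOn.taylor`). These are identities for polynomials over
  `𝒪`. They pass to the limit of the partial sums, because the derivatives of the partial sums
  stay in the compact ring `𝒪` and so converge along an ultrafilter.
* Put `r = 1 / (2 √‖t‖)` and `ρ = 2 / √‖t‖`. On a ball of radius `r` the character `Ψ` sees of
  `t f` only the linear part, as `‖t‖ r ^ 2 < 1`; if `‖grad f‖ ≥ ρ` there, then a translation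
  multiplies the integrand by a constant `≠ 1` and the integral over the ball vanishes
  (`setIntegral_closedBall_eq_zero_of_grad`). The Hessian at `x₀` is unimodular and the support
  of `φ` contains no other critical point, so for small `ρ` the inequality `‖x - x₀‖ ≥ ρ` implies
  `‖grad f x‖ ≥ ρ` (`exists_norm_grad_ge`). Only the ball of radius `ρ` about `x₀` remains
  (`setIntegral_eq_setIntegral_ball`).
* On that ball `‖t‖ ‖y‖ ^ 3 < 1`, so `f` may be replaced by half of its Hessian form
  (`setIntegral_ball_eq_quadratic`). As `2` is a unit, this form is diagonal with unit
  coefficients `a i` in suitable coordinates over the local ring `𝒪`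
  (`isUnitDiagonalizable_of_isSymm`). The coordinate change preserves norms and Haar measure, and
  the integral becomes a product (`setIntegral_quadratic_eq_prod`).
* The same localization in one variable replaces each radius `ρ` by the fixed disc `ϖ 𝒪`
  (`setIntegral_disc_eq_ball`), so that the exponent `1` serves for every `φ`.
-/

namespace StationaryPhase

/-! ### Taylor expansion of polynomials -/

section Polynomial

variable {R : Type*} [CommRing R] {n : ℕ}

/-- The restriction of the polynomial `P` to the line through `x` with direction `z`, as a
polynomial in the parameter of the line. -/
noncomputable def lineRestrict (x z : Fin n → R) : MvPolynomial (Fin n) R →ₐ[R] Polynomial R :=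
  MvPolynomial.aeval fun i => Polynomial.C (x i) + Polynomial.C (z i) * Polynomial.X

theorem eval_lineRestrict (x z : Fin n → R) (c : R) (P : MvPolynomial (Fin n) R) :
    (lineRestrict x z P).eval c = MvPolynomial.eval (x + c • z) P := by
  induction P using MvPolynomial.induction_on with
  | C a => simp [lineRestrict]
  | add p q hp hq => simp [hp, hq]
  | mul_X p i hp =>
    simp only [map_mul, Polynomial.eval_mul, hp]
    simp [lineRestrict, mul_comm c]

theorem derivative_lineRestrict (x z : Fin n → R) (P : MvPolynomial (Fin n) R) :
    Polynomial.derivative (lineRestrict x z P) =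
      ∑ i, Polynomial.C (z i) * lineRestrict x z (MvPolynomial.pderiv i P) := by
  induction P using MvPolynomial.induction_on with
  | C a => simp [lineRestrict]
  | add p q hp hq => simp [hp, hq, mul_add, Finset.sum_add_distrib]
  | mul_X p i hp =>
    simp only [map_mul, Polynomial.derivative_mul, hp, MvPolynomial.pderiv_mul, map_add,
      mul_add, Finset.sum_add_distrib, Finset.sum_mul, MvPolynomial.pderiv_X, Pi.single_apply]
    congr 1
    · exact Finset.sum_congr rfl fun j _ => by ring
    · rw [Finset.sum_eq_single i]
      · rw [mul_comm]
        simp [lineRestrict]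
      · intro j _ hj
        simp [hj.symm]
      · simp

theorem pderiv_comm (i j : Fin n) (P : MvPolynomial (Fin n) R) :
    MvPolynomial.pderiv i (MvPolynomial.pderiv j P) =
      MvPolynomial.pderiv j (MvPolynomial.pderiv i P) := by
  have h : ⁅MvPolynomial.pderiv (R := R) i, MvPolynomial.pderiv (R := R) j⁆ = 0 := by
    refine MvPolynomial.derivation_ext fun k => ?_
    simp only [Derivation.commutator_apply, MvPolynomial.pderiv_X, Derivation.zero_apply,
      Pi.single_apply]
    split_ifs <;> simp
  have := DFunLike.congr_fun h P
  simpa [Derivation.commutator_apply, sub_eq_zero] using this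

theorem eval_zero_lineRestrict (x z : Fin n → R) (P : MvPolynomial (Fin n) R) :
    (lineRestrict x z P).eval 0 = MvPolynomial.eval x P := by
  simp [eval_lineRestrict]

theorem dvd_eval_add_sub (P : MvPolynomial (Fin n) R) (x z : Fin n → R) (c : R) :
    ∃ q, MvPolynomial.eval (x + c • z) P - MvPolynomial.eval x P = c * q := by
  rw [← eval_lineRestrict, ← eval_zero_lineRestrict x z]
  have := Polynomial.sub_dvd_eval_sub c 0 (lineRestrict x z P)
  rwa [sub_zero] at this

theorem coeff_one_lineRestrict (x z : Fin n → R) (P : MvPolynomial (Fin n) R) :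
    (lineRestrict x z P).coeff 1 = ∑ i, z i * MvPolynomial.eval x (MvPolynomial.pderiv i P) := by
  have h := congrArg (Polynomial.eval 0) (derivative_lineRestrict x z P)
  rw [← Polynomial.coeff_zero_eq_eval_zero, Polynomial.coeff_derivative,
    Polynomial.eval_finsetSum] at h
  simpa [eval_zero_lineRestrict] using h

theorem two_mul_coeff_two_lineRestrict (x z : Fin n → R) (P : MvPolynomial (Fin n) R) :
    2 * (lineRestrict x z P).coeff 2 = ∑ i, ∑ j, z i * (z j *
      MvPolynomial.eval x (MvPolynomial.pderiv i (MvPolynomial.pderiv j P))) := by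
  have h := congrArg (fun p => Polynomial.coeff p 1) (derivative_lineRestrict x z P)
  simp only [Polynomial.coeff_derivative, Polynomial.finsetSum_coeff, Polynomial.coeff_C_mul,
    coeff_one_lineRestrict] at h
  rw [show 2 * (lineRestrict x z P).coeff 2 =
    (lineRestrict x z P).coeff (1 + 1) * (((1 : ℕ) : R) + 1) by norm_num; ring, h]
  refine Finset.sum_congr rfl fun i _ => ?_
  rw [Finset.mul_sum]
  refine Finset.sum_congr rfl fun j _ => ?_
  rw [pderiv_comm]

theorem eval_eq_coeffs (p : Polynomial R) (c : R) :
    p.eval c = p.coeff 0 + c * p.coeff 1 + c ^ 2 * p.coeff 2 +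
      c ^ 3 * p.divX.divX.divX.eval c := by
  have h (p : Polynomial R) : p.eval c = p.coeff 0 + c * p.divX.eval c := by
    conv_lhs => rw [← Polynomial.divX_mul_X_add p]
    simp; ring
  rw [h p, h p.divX, h p.divX.divX]
  simp only [Polynomial.coeff_divX]
  ring

theorem eval_taylor_two (P : MvPolynomial (Fin n) R) (x z : Fin n → R) (c : R) :
    ∃ q, MvPolynomial.eval (x + c • z) P - MvPolynomial.eval x P -
      ∑ i, c * z i * MvPolynomial.eval x (MvPolynomial.pderiv i P) = c ^ 2 * q := by
  refine ⟨(lineRestrict x z P).coeff 2 + c * (lineRestrict x z P).divX.divX.divX.eval c, ?_⟩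
  rw [← eval_lineRestrict, eval_eq_coeffs, coeff_one_lineRestrict,
    Polynomial.coeff_zero_eq_eval_zero, eval_zero_lineRestrict]
  simp only [mul_assoc, ← Finset.mul_sum]
  ring

theorem eval_taylor_three (P : MvPolynomial (Fin n) R) (x z : Fin n → R) (c : R) :
    ∃ q, 2 * (MvPolynomial.eval (x + c • z) P - MvPolynomial.eval x P -
      ∑ i, c * z i * MvPolynomial.eval x (MvPolynomial.pderiv i P)) -
      ∑ i, ∑ j, c * z i * (c * z j *
        MvPolynomial.eval x (MvPolynomial.pderiv i (MvPolynomial.pderiv j P))) = c ^ 3 * q := by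
  refine ⟨2 * (lineRestrict x z P).divX.divX.divX.eval c, ?_⟩
  have h : ∑ i, ∑ j, c * z i * (c * z j *
      MvPolynomial.eval x (MvPolynomial.pderiv i (MvPolynomial.pderiv j P))) =
      c ^ 2 * (2 * (lineRestrict x z P).coeff 2) := by
    rw [two_mul_coeff_two_lineRestrict, Finset.mul_sum]
    refine Finset.sum_congr rfl fun i _ => ?_
    rw [Finset.mul_sum]
    exact Finset.sum_congr rfl fun j _ => by ring
  rw [h, ← eval_lineRestrict, eval_eq_coeffs, coeff_one_lineRestrict,
    Polynomial.coeff_zero_eq_eval_zero, eval_zero_lineRestrict]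
  simp only [mul_assoc, ← Finset.mul_sum]
  ring

end Polynomial

/-! ### Taylor estimates for polynomials with integral coefficients -/

section IntegralPolynomial

variable {K : Type*} [NontriviallyNormedField K] [IsUltrametricDist K] {n : ℕ}

theorem norm_coe_le_one (a : integers K) : ‖(a : K)‖ ≤ 1 := a.2

theorem exists_lift {x : Fin n → K} (hx : ‖x‖ ≤ 1) :
    ∃ X : Fin n → integers K, x = fun i => (X i : K) :=
  ⟨fun i => ⟨x i, (norm_le_pi_norm x i).trans hx⟩, rfl⟩

/-- A vector is a scalar of the same norm times an integral vector. -/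
theorem exists_smul_lift {y : Fin n → K} (hy : ‖y‖ ≤ 1) :
    ∃ (c : integers K) (Z : Fin n → integers K), ‖(c : K)‖ = ‖y‖ ∧
      y = fun i => ((c * Z i : integers K) : K) := by
  rcases eq_or_ne y 0 with rfl | h0
  · exact ⟨0, 0, by simp, by ext i; simp⟩
  obtain ⟨j, hj⟩ := Function.ne_iff.1 h0
  have : Nonempty (Fin n) := ⟨j⟩
  obtain ⟨i, hi⟩ := (Finite.exists_max fun i => ‖y i‖)
  have hyi : ‖y‖ = ‖y i‖ := le_antisymm
    ((pi_norm_le_iff_of_nonneg (norm_nonneg _)).2 hi) (norm_le_pi_norm y i)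
  have hpos : 0 < ‖y i‖ := hyi ▸ norm_pos_iff.2 h0
  refine ⟨⟨y i, by rw [mem_integers, ← hyi]; exact hy⟩, fun k => ⟨y k / y i, ?_⟩, hyi.symm, ?_⟩
  · rw [mem_integers, norm_div]
    exact div_le_one_of_le₀ (hi k) hpos.le
  · ext k
    exact (mul_div_cancel₀ (y k) (norm_pos_iff.1 hpos)).symm

theorem aeval_coe (X : Fin n → integers K) (P : MvPolynomial (Fin n) (integers K)) :
    MvPolynomial.aeval (fun i => (X i : K)) P = ((MvPolynomial.eval X P : integers K) : K) :=
  MvPolynomial.aeval_algebraMap_apply K X P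

theorem norm_aeval_le_one {x : Fin n → K} (hx : ‖x‖ ≤ 1) (P : MvPolynomial (Fin n) (integers K)) :
    ‖MvPolynomial.aeval x P‖ ≤ 1 := by
  obtain ⟨X, rfl⟩ := exists_lift hx
  rw [aeval_coe]
  exact norm_coe_le_one _

theorem norm_pow_mul_coe_le {c q : integers K} {y : Fin n → K} (hc : ‖(c : K)‖ = ‖y‖) (k : ℕ) :
    ‖((c ^ k * q : integers K) : K)‖ ≤ ‖y‖ ^ k := by
  push_cast
  rw [norm_mul, norm_pow, hc]
  exact mul_le_of_le_one_right (by positivity) (norm_coe_le_one q)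

theorem norm_aeval_add_sub_le {x y : Fin n → K} (hx : ‖x‖ ≤ 1) (hy : ‖y‖ ≤ 1)
    (P : MvPolynomial (Fin n) (integers K)) :
    ‖MvPolynomial.aeval (x + y) P - MvPolynomial.aeval x P‖ ≤ ‖y‖ := by
  obtain ⟨X, rfl⟩ := exists_lift hx
  obtain ⟨c, Z, hc, hyc⟩ := exists_smul_lift hy
  obtain ⟨q, hq⟩ := dvd_eval_add_sub P X Z c
  have e : (fun i => (X i : K)) + y = fun i => (((X + c • Z) i : integers K) : K) := by
    ext i; simp [hyc]
  rw [e, aeval_coe, aeval_coe]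
  have := norm_pow_mul_coe_le (q := q) hc 1
  rw [pow_one, pow_one, ← hq] at this
  exact_mod_cast this

theorem norm_aeval_taylor_two_le {x y : Fin n → K} (hx : ‖x‖ ≤ 1) (hy : ‖y‖ ≤ 1)
    (P : MvPolynomial (Fin n) (integers K)) :
    ‖MvPolynomial.aeval (x + y) P - MvPolynomial.aeval x P -
      ∑ i, y i * MvPolynomial.aeval x (MvPolynomial.pderiv i P)‖ ≤ ‖y‖ ^ 2 := by
  obtain ⟨X, rfl⟩ := exists_lift hx
  obtain ⟨c, Z, hc, hyc⟩ := exists_smul_lift hy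
  obtain ⟨q, hq⟩ := eval_taylor_two P X Z c
  have e : (fun i => (X i : K)) + y = fun i => (((X + c • Z) i : integers K) : K) := by
    ext i; simp [hyc]
  have := norm_pow_mul_coe_le (q := q) hc 2
  rw [← hq] at this
  simp only [e, aeval_coe]
  convert this using 2
  simp [hyc]

theorem norm_aeval_taylor_three_le {x y : Fin n → K} (hx : ‖x‖ ≤ 1) (hy : ‖y‖ ≤ 1)
    (P : MvPolynomial (Fin n) (integers K)) :
    ‖2 * (MvPolynomial.aeval (x + y) P - MvPolynomial.aeval x P -
      ∑ i, y i * MvPolynomial.aeval x (MvPolynomial.pderiv i P)) -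
      ∑ i, ∑ j, y i * (y j * MvPolynomial.aeval x
        (MvPolynomial.pderiv i (MvPolynomial.pderiv j P)))‖ ≤ ‖y‖ ^ 3 := by
  obtain ⟨X, rfl⟩ := exists_lift hx
  obtain ⟨c, Z, hc, hyc⟩ := exists_smul_lift hy
  obtain ⟨q, hq⟩ := eval_taylor_three P X Z c
  have e : (fun i => (X i : K)) + y = fun i => (((X + c • Z) i : integers K) : K) := by
    ext i; simp [hyc]
  have := norm_pow_mul_coe_le (q := q) hc 3
  rw [← hq] at this
  simp only [e, aeval_coe]
  convert this using 2
  have h2 : ((2 : integers K) : K) = 2 := rfl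
  simp [hyc, h2]

end IntegralPolynomial

/-! ### Taylor estimates for globally analytic functions -/

section Analytic

open Filter Topology

variable {K : Type*} [NontriviallyNormedField K] [IsUltrametricDist K] {n : ℕ}

/-- The polynomial formed by the terms of `F` with exponents in `S`. -/
noncomputable def partialSum (F : MvPowerSeries (Fin n) (integers K)) (S : Finset (Fin n →₀ ℕ)) :
    MvPolynomial (Fin n) (integers K) :=
  ∑ d ∈ S, MvPolynomial.monomial d (MvPowerSeries.coeff d F)

theorem aeval_partialSum (F : MvPowerSeries (Fin n) (integers K)) (S : Finset (Fin n →₀ ℕ))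
    (x : Fin n → K) : MvPolynomial.aeval x (partialSum F S) =
      ∑ d ∈ S, ((MvPowerSeries.coeff d F : integers K) : K) * ∏ i, x i ^ d i := by
  rw [partialSum, map_sum]
  refine Finset.sum_congr rfl fun d _ => ?_
  rw [MvPolynomial.aeval_monomial, Finsupp.prod_fintype _ _ (by simp)]
  rfl

theorem hasDerivAt_of_norm_sub_le_sq {K : Type*} [NontriviallyNormedField K] {g : K → K} {D : K}
    (h : ∀ᶠ c in 𝓝 (0 : K), ‖g c - g 0 - c * D‖ ≤ ‖c‖ ^ 2) : HasDerivAt g D 0 := by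
  rw [hasDerivAt_iff_isLittleO]
  have h1 : (fun c : K => g c - g 0 - (c - 0) • D) =O[𝓝 0] fun c => c ^ 2 := by
    refine Asymptotics.IsBigO.of_bound 1 ?_
    filter_upwards [h] with c hc
    simpa using hc
  refine h1.trans_isLittleO ?_
  simpa using Asymptotics.isLittleO_pow_id (𝕜 := K) one_lt_two

/-- Second-order Taylor bounds with integral remainder in the coordinate directions determine the
partial derivatives. -/
theorem partialDeriv_eq_of_taylor {K : Type*} [NontriviallyNormedField K] {g : (Fin n → K) → K} {Ω : Set (Fin n → K)} (hΩ : IsOpen Ω)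
    {D : Fin n → K} {x : Fin n → K} (hx : x ∈ Ω)
    (h : ∀ y, x + y ∈ Ω → ‖g (x + y) - g x - ∑ i, y i * D i‖ ≤ ‖y‖ ^ 2) (i : Fin n) :
    partialDeriv i g x = D i := by
  have hd : HasDerivAt (fun t : K => g (x + t • Pi.single i (1 : K))) (D i) 0 := by
    refine hasDerivAt_of_norm_sub_le_sq ?_
    have hc : ContinuousAt (fun t : K => x + t • (Pi.single i (1 : K) : Fin n → K)) 0 := by fun_prop
    have hmem : ∀ᶠ t in 𝓝 (0 : K), x + t • (Pi.single i (1 : K) : Fin n → K) ∈ Ω :=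
      hc.eventually (by simpa using hΩ.mem_nhds hx)
    filter_upwards [hmem] with c hc
    have := h _ hc
    rw [Finset.sum_eq_single i (fun j _ hj => by simp [hj]) (by simp)] at this
    refine (le_of_eq ?_).trans (this.trans (pow_le_pow_left₀ (norm_nonneg _) ?_ 2))
    · simp
    · rw [norm_smul]
      refine mul_le_of_le_one_right (norm_nonneg _) ?_
      refine (pi_norm_le_iff_of_nonneg zero_le_one).2 fun j => ?_
      rcases eq_or_ne j i with rfl | hj
      · simp
      · simp [hj]
  exact hd.deriv

/-- The Taylor expansion of a globally analytic function, with integral remainders.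
A bound on partial sums passes to the limit; compactness of the valuation ring provides limits
of the derivatives of the partial sums along an ultrafilter. -/
theorem GloballyAnalyticOn.taylor [LocallyCompactSpace K] {f : (Fin n → K) → K}
    {Ω : Set (Fin n → K)} (hΩ : IsOpen Ω) (hΩ_int : ∀ x ∈ Ω, ∀ i, x i ∈ integers K)
    (hf : GloballyAnalyticOn f Ω) :
    (∀ x y, x ∈ Ω → x + y ∈ Ω → ‖f (x + y) - f x‖ ≤ ‖y‖) ∧
    (∀ x y, x ∈ Ω → x + y ∈ Ω → ‖f (x + y) - f x - grad f x ⬝ᵥ y‖ ≤ ‖y‖ ^ 2) ∧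
    (∀ x y, x ∈ Ω → x + y ∈ Ω → ‖grad f (x + y) - grad f x‖ ≤ ‖y‖) ∧
    (∀ x y, x ∈ Ω → x + y ∈ Ω →
      ‖grad f (x + y) - grad f x - (hessian f x).mulVec y‖ ≤ ‖y‖ ^ 2) ∧
    (∀ x y, x ∈ Ω → x + y ∈ Ω →
      ‖2 * (f (x + y) - f x - grad f x ⬝ᵥ y) - y ⬝ᵥ (hessian f x).mulVec y‖ ≤ ‖y‖ ^ 3) ∧
    (∀ x ∈ Ω, ∀ i j, hessian f x i j ∈ integers K) ∧
    (∀ x ∈ Ω, (hessian f x).IsSymm) := by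
  have : ProperSpace K := ProperSpace.of_locallyCompactSpace K
  obtain ⟨-, F, hF⟩ := hf
  let 𝒰 : Ultrafilter (Finset (Fin n →₀ ℕ)) := Ultrafilter.of atTop
  have hle (x : Fin n → K) (hx : x ∈ Ω) : ‖x‖ ≤ 1 :=
    (pi_norm_le_iff_of_nonneg zero_le_one).2 (hΩ_int x hx)
  have hle' (x y : Fin n → K) (hx : x ∈ Ω) (hxy : x + y ∈ Ω) : ‖y‖ ≤ 1 := by
    have := IsUltrametricDist.norm_add_le_max (x + y) (-x)
    rw [norm_neg, add_neg_cancel_comm] at this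
    exact this.trans (max_le (hle _ hxy) (hle _ hx))
  have hlim (g : MvPolynomial (Fin n) (integers K) → MvPolynomial (Fin n) (integers K))
      (x : Fin n → K) : ∃ l : K, x ∈ Ω → ‖l‖ ≤ 1 ∧
        Tendsto (fun S => MvPolynomial.aeval x (g (partialSum F S))) 𝒰 (𝓝 l) := by
    by_cases hx : x ∈ Ω
    · obtain ⟨l, hl, h⟩ := (isCompact_closedBall (0 : K) 1).ultrafilter_le_nhds'
        (𝒰.map fun S => MvPolynomial.aeval x (g (partialSum F S)))
        (Filter.mem_map.2 (Filter.Eventually.of_forall fun S => by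
          simpa using norm_aeval_le_one (hle x hx) (g (partialSum F S))))
      exact ⟨l, fun _ => ⟨by simpa using hl, h⟩⟩
    · exact ⟨0, fun h => absurd h hx⟩
  choose D hD using fun i => hlim (MvPolynomial.pderiv i)
  choose E hE using fun i j =>
    hlim (fun P => MvPolynomial.pderiv i (MvPolynomial.pderiv j P))
  have hf0 (x : Fin n → K) (hx : x ∈ Ω) :
      Tendsto (fun S => MvPolynomial.aeval x (partialSum F S)) 𝒰 (𝓝 (f x)) := by
    have h : Tendsto (fun S => MvPolynomial.aeval x (partialSum F S)) atTop (𝓝 (f x)) := by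
      simpa only [aeval_partialSum, HasSum, SummationFilter.unconditional_filter] using hF x hx
    exact h.mono_left (Ultrafilter.of_le _)
  have hD0 (i) (x) (hx : x ∈ Ω) := (hD i x hx).2
  have hE0 (i j) (x) (hx : x ∈ Ω) := (hE i j x hx).2
  have hgrad (x : Fin n → K) (hx : x ∈ Ω) (i : Fin n) : partialDeriv i f x = D i x := by
    refine partialDeriv_eq_of_taylor (D := fun i => D i x) hΩ hx (fun y hy => ?_) i
    refine le_of_tendsto (((hf0 _ hy).sub (hf0 _ hx)).sub
      (tendsto_finsetSum _ fun i _ => (hD0 i x hx).const_mul (y i))).norm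
      (Eventually.of_forall fun S => ?_)
    exact norm_aeval_taylor_two_le (hle x hx) (hle' x y hx hy) _
  have hgrad' (x : Fin n → K) (hx : x ∈ Ω) : grad f x = fun i => D i x :=
    funext fun i => hgrad x hx i
  have hT (x y : Fin n → K) (hx : x ∈ Ω) (hy : x + y ∈ Ω) (i : Fin n) :
      ‖D i (x + y) - D i x - ∑ j, y j * E j i x‖ ≤ ‖y‖ ^ 2 := by
    refine le_of_tendsto (((hD0 i _ hy).sub (hD0 i _ hx)).sub
      (tendsto_finsetSum _ fun j _ => (hE0 j i x hx).const_mul (y j))).norm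
      (Eventually.of_forall fun S => ?_)
    exact norm_aeval_taylor_two_le (hle x hx) (hle' x y hx hy) _
  have hhess (x : Fin n → K) (hx : x ∈ Ω) : hessian f x = Matrix.of fun i j => E i j x := by
    ext i j
    refine partialDeriv_eq_of_taylor (D := fun i => E i j x) hΩ hx (fun y hy => ?_) i
    rw [hgrad _ hx, hgrad _ hy]
    exact hT x y hx hy j
  have hsymm (x : Fin n → K) (hx : x ∈ Ω) (i j : Fin n) : E i j x = E j i x := by
    refine tendsto_nhds_unique (hE0 i j x hx) ?_
    simpa only [pderiv_comm i j] using hE0 j i x hx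
  refine ⟨fun x y hx hy => ?_, fun x y hx hy => ?_, fun x y hx hy => ?_, fun x y hx hy => ?_,
    fun x y hx hy => ?_, fun x hx i j => ?_, fun x hx => ?_⟩
  · refine le_of_tendsto ((hf0 _ hy).sub (hf0 _ hx)).norm (Eventually.of_forall fun S => ?_)
    exact norm_aeval_add_sub_le (hle x hx) (hle' x y hx hy) _
  · have h : grad f x ⬝ᵥ y = ∑ i, y i * D i x := by
      rw [dotProduct_comm, hgrad' x hx, dotProduct]
    rw [h]
    refine le_of_tendsto (((hf0 _ hy).sub (hf0 _ hx)).sub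
      (tendsto_finsetSum _ fun i _ => (hD0 i x hx).const_mul (y i))).norm
      (Eventually.of_forall fun S => ?_)
    exact norm_aeval_taylor_two_le (hle x hx) (hle' x y hx hy) _
  · rw [hgrad' _ hx, hgrad' _ hy]
    refine (pi_norm_le_iff_of_nonneg (norm_nonneg _)).2 fun i => ?_
    refine le_of_tendsto ((hD0 i _ hy).sub (hD0 i _ hx)).norm (Eventually.of_forall fun S => ?_)
    exact norm_aeval_add_sub_le (hle x hx) (hle' x y hx hy) _
  · rw [hgrad' _ hx, hgrad' _ hy, hhess x hx]
    refine (pi_norm_le_iff_of_nonneg (by positivity)).2 fun i => ?_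
    have h : (Matrix.of fun i j => E i j x).mulVec y i = ∑ j, y j * E j i x := by
      rw [Matrix.mulVec, dotProduct]
      exact Finset.sum_congr rfl fun j _ => by rw [Matrix.of_apply, hsymm x hx i j, mul_comm]
    rw [Pi.sub_apply, Pi.sub_apply, h]
    exact hT x y hx hy i
  · have h : grad f x ⬝ᵥ y = ∑ i, y i * D i x := by
      rw [dotProduct_comm, hgrad' x hx, dotProduct]
    have h' : y ⬝ᵥ (hessian f x).mulVec y = ∑ i, ∑ j, y i * (y j * E i j x) := by
      rw [hhess x hx]
      refine Finset.sum_congr rfl fun i _ => ?_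
      rw [Matrix.mulVec, dotProduct, Finset.mul_sum]
      exact Finset.sum_congr rfl fun j _ => by rw [Matrix.of_apply, mul_comm (y j)]
    rw [h, h']
    refine le_of_tendsto (((((hf0 _ hy).sub (hf0 _ hx)).sub
      (tendsto_finsetSum _ fun i _ => (hD0 i x hx).const_mul (y i))).const_mul 2).sub
      (tendsto_finsetSum _ fun i _ => tendsto_finsetSum _ fun j _ =>
        ((hE0 i j x hx).const_mul (y j)).const_mul (y i))).norm
      (Eventually.of_forall fun S => ?_)
    exact norm_aeval_taylor_three_le (hle x hx) (hle' x y hx hy) _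
  · rw [hhess x hx]
    exact (hE i j x hx).1
  · rw [hhess x hx]
    ext i j
    exact hsymm x hx j i

end Analytic

/-! ### Diagonalization of unimodular symmetric matrices -/

section Diagonalization

variable {R : Type*} [CommRing R]

/-- The symmetric matrix `A` is congruent over `R` to a diagonal matrix with unit entries. -/
def IsUnitDiagonalizable {ι : Type*} [Fintype ι] [DecidableEq ι] (A : Matrix ι ι R) : Prop :=
  ∃ P : Matrix ι ι R, IsUnit P.det ∧ ∃ a : ι → Rˣ,
    A = P.transpose * Matrix.diagonal (fun i => (a i : R)) * P

theorem IsUnitDiagonalizable.of_congr {ι : Type*} [Fintype ι] [DecidableEq ι] {A Q : Matrix ι ι R}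
    (hQ : IsUnit Q.det) (h : IsUnitDiagonalizable (Q.transpose * A * Q)) :
    IsUnitDiagonalizable A := by
  obtain ⟨P, hP, a, h⟩ := h
  refine ⟨P * Q⁻¹, ?_, a, ?_⟩
  · rw [Matrix.det_mul]
    exact hP.mul (Matrix.isUnit_nonsing_inv_det Q hQ)
  · have hQ' : IsUnit Q.transpose.det := by rwa [Matrix.det_transpose]
    calc A = Q.transpose⁻¹ * (Q.transpose * A * Q) * Q⁻¹ := by
          rw [Matrix.mul_assoc, Matrix.mul_assoc, Matrix.mul_assoc, Matrix.mul_nonsing_inv _ hQ,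
            Matrix.mul_one, Matrix.nonsing_inv_mul_cancel_left _ _ hQ']
      _ = _ := by
          rw [h, Matrix.transpose_mul, Matrix.transpose_nonsing_inv]
          simp only [Matrix.mul_assoc]

theorem IsUnitDiagonalizable.of_submatrix {ι κ : Type*} [Fintype ι] [DecidableEq ι] [Fintype κ]
    [DecidableEq κ] {A : Matrix ι ι R} (e : κ ≃ ι)
    (h : IsUnitDiagonalizable (A.submatrix e e)) : IsUnitDiagonalizable A := by
  obtain ⟨P, hP, a, h⟩ := h
  refine ⟨P.submatrix e.symm e.symm, by rwa [Matrix.det_submatrix_equiv_self],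
    fun i => a (e.symm i), ?_⟩
  have hd : Matrix.diagonal (fun i => (a (e.symm i) : R)) =
      (Matrix.diagonal fun i => (a i : R)).submatrix e.symm e.symm := by
    rw [Matrix.submatrix_diagonal_equiv]
    rfl
  rw [hd, Matrix.transpose_submatrix, Matrix.submatrix_mul_equiv, Matrix.submatrix_mul_equiv, ← h]
  simp

/-- A block decomposition reduces the diagonalization to the Schur complement of a diagonal unit
entry. -/
theorem IsUnitDiagonalizable.fromBlocks {m κ : Type*} [Fintype m] [DecidableEq m] [Unique m]
    [Fintype κ] [DecidableEq κ] {A : Matrix m m R} {B : Matrix m κ R} {D : Matrix κ κ R}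
    [Invertible A]
    (h : IsUnitDiagonalizable (D - B.transpose * ⅟A * B)) :
    IsUnitDiagonalizable (Matrix.fromBlocks A B B.transpose D) := by
  obtain ⟨P, hP, a, h⟩ := h
  have hAu : IsUnit A.det := (Matrix.isUnit_iff_isUnit_det A).1 (isUnit_of_invertible A)
  have hAdiag : A = Matrix.diagonal fun _ => A.det := by
    ext i j
    rw [Subsingleton.elim i default, Subsingleton.elim j default, Matrix.diagonal_apply_eq,
      Matrix.det_unique]
  have hAT : A.transpose = A := by rw [hAdiag, Matrix.diagonal_transpose]
  refine ⟨Matrix.fromBlocks 1 0 0 P * Matrix.fromBlocks 1 (⅟A * B) 0 1, ?_,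
    Sum.elim (fun _ => hAu.unit) a, ?_⟩
  · simpa [Matrix.det_mul] using hP
  · have hd : Matrix.diagonal (fun i => ((Sum.elim (fun _ : m => hAu.unit) a i : Rˣ) : R)) =
        Matrix.fromBlocks A 0 0 (Matrix.diagonal fun i => (a i : R)) := by
      conv_rhs => rw [hAdiag]
      rw [Matrix.fromBlocks_diagonal]
      congr 1
      ext (i | i) <;> simp
    have hinv : (⅟A).transpose = ⅟A := by
      rw [Matrix.invOf_eq_nonsing_inv, Matrix.transpose_nonsing_inv, hAT]
    rw [Matrix.fromBlocks_eq_of_invertible₁₁ A B B.transpose D, h, hd]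
    simp only [Matrix.transpose_mul, Matrix.fromBlocks_transpose, Matrix.transpose_one,
      Matrix.transpose_zero, hinv, Matrix.mul_assoc]
    rw [← Matrix.mul_assoc (Matrix.fromBlocks A 0 0 _) (Matrix.fromBlocks 1 0 0 P),
      ← Matrix.mul_assoc (Matrix.fromBlocks 1 0 0 P.transpose)]
    simp [Matrix.fromBlocks_multiply]

theorem exists_isUnit_entry [IsLocalRing R] {ι : Type*} [Fintype ι] [DecidableEq ι]
    {A : Matrix ι ι R} (hA : IsUnit A.det) (i : ι) : ∃ j, IsUnit (A i j) := by
  by_contra! h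
  rw [Matrix.det_eq_sum_mul_adjugate_row A i] at hA
  have : ∑ j, A i j * A.adjugate j i ∈ IsLocalRing.maximalIdeal R :=
    Ideal.sum_mem _ fun j _ => Ideal.mul_mem_right _ _ ((IsLocalRing.mem_maximalIdeal _).2 (h j))
  exact this hA

/-- After a unimodular congruence, a unimodular symmetric matrix has a unit on its diagonal: if
`A i j` is a unit and `A i i`, `A j j` are not, then `A i i + A j j + 2 A i j` is one. -/
theorem exists_congr_isUnit_diag [IsLocalRing R] (h2 : IsUnit (2 : R)) {ι : Type*} [Fintype ι]
    [DecidableEq ι] [Nonempty ι] {A : Matrix ι ι R} (hs : A.IsSymm) (hA : IsUnit A.det) :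
    ∃ Q : Matrix ι ι R, IsUnit Q.det ∧ ∃ i, IsUnit ((Q.transpose * A * Q) i i) := by
  obtain ⟨i⟩ := ‹Nonempty ι›
  obtain ⟨j, hj⟩ := exists_isUnit_entry hA i
  by_cases hi : IsUnit (A i i)
  · exact ⟨1, by simp, i, by simpa using hi⟩
  by_cases hj' : IsUnit (A j j)
  · exact ⟨1, by simp, j, by simpa using hj'⟩
  have hij : j ≠ i := by
    rintro rfl
    exact hi hj
  refine ⟨Matrix.transvection j i 1, by simp [Matrix.det_transvection_of_ne _ _ hij], i, ?_⟩
  have he : ((Matrix.transvection j i (1 : R)).transpose * A *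
      Matrix.transvection j i (1 : R) : Matrix ι ι R) i i = A i i + A j j + 2 * A i j := by
    have : A j i = A i j := hs.apply i j
    simp [Matrix.transvection, Matrix.mul_add, Matrix.add_mul, this]
    ring
  rw [he]
  by_contra hn
  have h1 := (IsLocalRing.maximalIdeal R).sub_mem ((IsLocalRing.mem_maximalIdeal _).2 hn)
    ((IsLocalRing.maximalIdeal R).add_mem ((IsLocalRing.mem_maximalIdeal _).2 hi)
      ((IsLocalRing.mem_maximalIdeal _).2 hj'))
  rw [add_sub_cancel_left] at h1
  exact h1 (h2.mul hj)

/-- Over a local ring in which `2` is a unit, unimodular symmetric matrices are diagonalizable by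
unimodular congruences. -/
theorem isUnitDiagonalizable_of_isSymm [IsLocalRing R] (h2 : IsUnit (2 : R)) {ι : Type*}
    [Fintype ι] [DecidableEq ι] {A : Matrix ι ι R} (hs : A.IsSymm) (hA : IsUnit A.det) :
    IsUnitDiagonalizable A := by
  induction hk : Fintype.card ι using Nat.strong_induction_on generalizing ι with
  | _ k ih =>
  rcases isEmpty_or_nonempty ι with h0 | h0
  · exact ⟨1, by simp, fun _ => 1, Subsingleton.elim _ _⟩
  obtain ⟨Q, hQ, i, hi⟩ := exists_congr_isUnit_diag h2 hs hA
  refine IsUnitDiagonalizable.of_congr hQ ?_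
  have hs' : (Q.transpose * A * Q).IsSymm := by
    rw [Matrix.IsSymm, Matrix.transpose_mul, Matrix.transpose_mul, Matrix.transpose_transpose, hs,
      Matrix.mul_assoc]
  have hdet : IsUnit (Q.transpose * A * Q).det := by
    rw [Matrix.det_mul, Matrix.det_mul, Matrix.det_transpose]
    exact (hQ.mul hA).mul hQ
  generalize Q.transpose * A * Q = A' at hi hs' hdet
  refine IsUnitDiagonalizable.of_submatrix (Equiv.sumCompl fun j => j = i) ?_
  set A'' := A'.submatrix (Equiv.sumCompl fun j => j = i) (Equiv.sumCompl fun j => j = i)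
    with hA''
  have hs'' : A''.IsSymm := hs'.submatrix _
  have hdet'' : IsUnit A''.det := by rwa [hA'', Matrix.det_submatrix_equiv_self]
  have hB : A''.toBlocks₂₁ = A''.toBlocks₁₂.transpose := by
    ext a b
    exact hs''.apply _ _
  have hu : IsUnit A''.toBlocks₁₁.det := by
    rw [Matrix.det_unique]
    exact hi
  let _ : Invertible A''.toBlocks₁₁ := Matrix.invertibleOfIsUnitDet _ hu
  rw [← Matrix.fromBlocks_toBlocks A'', hB] at hdet'' hs'' ⊢
  rw [Matrix.det_fromBlocks₁₁] at hdet''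
  rw [Matrix.isSymm_fromBlocks_iff] at hs''
  refine IsUnitDiagonalizable.fromBlocks (ih _ ?_ ?_ (isUnit_of_mul_isUnit_right hdet'') rfl)
  · rw [← hk]
    exact Fintype.card_subtype_lt (x := i) (by simp)
  · rw [Matrix.IsSymm, Matrix.transpose_sub, hs''.2.2.2, Matrix.transpose_mul,
      Matrix.transpose_mul, Matrix.invOf_eq_nonsing_inv, Matrix.transpose_nonsing_inv, hs''.1,
      Matrix.transpose_transpose, Matrix.mul_assoc]

end Diagonalization

/-! ### Unimodular matrices and Haar measure -/

section IntegralMatrix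

variable {K : Type*} [NontriviallyNormedField K] [IsUltrametricDist K] {n : ℕ}

theorem isUnit_iff_norm_eq_one {a : integers K} : IsUnit a ↔ ‖(a : K)‖ = 1 := by
  rw [← not_iff_not, ← mem_nonunits_iff, ← IsLocalRing.mem_maximalIdeal, mem_maximalIdeal_iff]
  exact ⟨fun h => h.ne, fun h => lt_of_le_of_ne (norm_coe_le_one a) h⟩

theorem isUnit_two (h_char : ringChar (IsLocalRing.ResidueField (integers K)) ≠ 2) :
    IsUnit (2 : integers K) := by
  rw [← IsLocalRing.residue_ne_zero_iff_isUnit, map_ofNat]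
  exact Ring.two_ne_zero h_char

theorem mem_disc_one {ϖ : integers K} (hϖ : IsUniformizer ϖ) {u : K} :
    u ∈ disc ϖ 1 ↔ ‖u‖ < 1 := by
  constructor
  · rintro ⟨z, hz, rfl⟩
    rw [pow_one, norm_mul]
    exact (mul_le_of_le_one_right hϖ.norm_pos.le hz).trans_lt hϖ.norm_lt_one
  · intro hu
    have : (⟨u, hu.le⟩ : integers K) ∈ IsLocalRing.maximalIdeal (integers K) :=
      mem_maximalIdeal_iff.2 hu
    rw [hϖ, Ideal.mem_span_singleton] at this
    obtain ⟨z, hz⟩ := this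
    exact ⟨z, z.2, by rw [pow_one]; exact congrArg Subtype.val hz⟩

theorem norm_mulVec_le (A : Matrix (Fin n) (Fin n) (integers K)) (y : Fin n → K) :
    ‖(A.map (algebraMap (integers K) K)).mulVec y‖ ≤ ‖y‖ := by
  refine (pi_norm_le_iff_of_nonneg (norm_nonneg _)).2 fun i => ?_
  rw [Matrix.mulVec, dotProduct]
  refine IsUltrametricDist.norm_sum_le_of_forall_le_of_nonneg (norm_nonneg _) fun j _ => ?_
  rw [norm_mul]
  exact (mul_le_of_le_one_left (norm_nonneg _) (norm_coe_le_one (A i j))).trans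
    (norm_le_pi_norm y j)

/-- A matrix in `GL n 𝒪` as a continuous linear automorphism of `K ^ n`. -/
noncomputable def unimodularEquiv (P : Matrix (Fin n) (Fin n) (integers K)) (hP : IsUnit P.det) :
    (Fin n → K) ≃L[K] (Fin n → K) where
  toFun := (P.map (algebraMap (integers K) K)).mulVec
  invFun := (P⁻¹.map (algebraMap (integers K) K)).mulVec
  map_add' := Matrix.mulVec_add _
  map_smul' c x := Matrix.mulVec_smul _ c x
  left_inv x := by
    rw [Matrix.mulVec_mulVec, ← Matrix.map_mul, Matrix.nonsing_inv_mul _ hP,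
      Matrix.map_one _ (map_zero _) (map_one _), Matrix.one_mulVec]
  right_inv x := by
    rw [Matrix.mulVec_mulVec, ← Matrix.map_mul, Matrix.mul_nonsing_inv _ hP,
      Matrix.map_one _ (map_zero _) (map_one _), Matrix.one_mulVec]
  continuous_toFun := by fun_prop
  continuous_invFun := by fun_prop

theorem unimodularEquiv_apply (P : Matrix (Fin n) (Fin n) (integers K)) (hP : IsUnit P.det)
    (y : Fin n → K) :
    unimodularEquiv P hP y = (P.map (algebraMap (integers K) K)).mulVec y := rfl

theorem norm_unimodularEquiv (P : Matrix (Fin n) (Fin n) (integers K)) (hP : IsUnit P.det)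
    (y : Fin n → K) : ‖unimodularEquiv P hP y‖ = ‖y‖ := by
  refine le_antisymm (norm_mulVec_le P y) ?_
  conv_lhs => rw [← (unimodularEquiv P hP).symm_apply_apply y]
  exact norm_mulVec_le P⁻¹ _

/-- Automorphisms in `GL n 𝒪` preserve every Haar measure, as they preserve the unit ball. -/
theorem measurePreserving_unimodularEquiv [ProperSpace K] [MeasurableSpace K] [BorelSpace K]
    (ν : Measure (Fin n → K)) [ν.IsAddHaarMeasure]
    (P : Matrix (Fin n) (Fin n) (integers K)) (hP : IsUnit P.det) :
    MeasurePreserving (unimodularEquiv P hP) ν ν := by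
  refine ⟨(unimodularEquiv P hP).continuous.measurable, ?_⟩
  have := (unimodularEquiv P hP).isAddHaarMeasure_map ν
  have h := Measure.isAddLeftInvariant_eq_smul (Measure.map (unimodularEquiv P hP) ν) ν
  have hb := congrArg (fun m => m (Metric.closedBall 0 1)) h
  have hpre : unimodularEquiv P hP ⁻¹' Metric.closedBall 0 1 = Metric.closedBall 0 1 := by
    ext y
    simp [norm_unimodularEquiv]
  simp only [Measure.smul_apply] at hb
  rw [Measure.map_apply (unimodularEquiv P hP).continuous.measurable
    Metric.isClosed_closedBall.measurableSet, hpre] at hb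
  have h0 : ν (Metric.closedBall 0 1) ≠ 0 :=
    (Metric.measure_closedBall_pos ν _ one_pos).ne'
  have ht : ν (Metric.closedBall 0 1) ≠ ⊤ := (isCompact_closedBall _ _).measure_lt_top.ne
  have h1 : (Measure.addHaarScalarFactor (Measure.map (unimodularEquiv P hP) ν) ν : ENNReal) = 1 :=
    ((ENNReal.mul_eq_right h0 ht).1 hb.symm)
  rw [h, ENNReal.coe_eq_one.1 h1, one_smul]

end IntegralMatrix

/-! ### Localization of integrals in ultrametric groups -/

section Vanishing

variable {E : Type*} [NormedAddCommGroup E] [IsUltrametricDist E] [MeasurableSpace E]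
  [BorelSpace E]

/-- If a translation preserving a ball multiplies `F` by a constant other than `1`, then the
integral of `F` over the ball vanishes. -/
theorem setIntegral_closedBall_eq_zero (ν : Measure E) [ν.IsAddLeftInvariant] {F : E → ℂ} {x y₀ : E} {r : ℝ} {c : ℂ} (hy₀ : ‖y₀‖ ≤ r)
    (hc : c ≠ 1) (hF : ∀ y ∈ Metric.closedBall x r, F (y₀ + y) = c * F y) :
    ∫ y in Metric.closedBall x r, F y ∂ν = 0 := by
  have hpre : (fun y => y₀ + y) ⁻¹' Metric.closedBall x r = Metric.closedBall x r := by
    have key (y z : E) (hz : ‖z‖ ≤ r) (hy : y ∈ Metric.closedBall x r) :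
        z + y ∈ Metric.closedBall x r := by
      rw [mem_closedBall_iff_norm] at hy ⊢
      rw [add_sub_assoc]
      exact (IsUltrametricDist.norm_add_le_max _ _).trans (max_le hz hy)
    ext y
    refine ⟨fun h => ?_, key y y₀ hy₀⟩
    simpa using key (y₀ + y) (-y₀) (by rwa [norm_neg]) h
  have h1 := (measurePreserving_add_left ν y₀).setIntegral_preimage_emb
    (measurableEmbedding_addLeft y₀) F (Metric.closedBall x r)
  rw [hpre, setIntegral_congr_fun Metric.isClosed_closedBall.measurableSet hF,
    integral_const_mul] at h1
  have h2 : (c - 1) * ∫ y in Metric.closedBall x r, F y ∂ν = 0 := by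
    rw [sub_mul, h1, one_mul, sub_self]
  exact (mul_eq_zero.1 h2).resolve_left (sub_ne_zero.2 hc)

/-- A compact set that is a union of balls of the same radius is a finite disjoint union of such
balls. -/
theorem setIntegral_eq_zero_of_closedBall (ν : Measure E) {F : E → ℂ} {S : Set E} (hS : IsCompact S) {r : ℝ}
    (hr : 0 < r) (hFi : IntegrableOn F S ν) (hSr : ∀ x ∈ S, Metric.closedBall x r ⊆ S)
    (hF : ∀ x ∈ S, ∫ y in Metric.closedBall x r, F y ∂ν = 0) : ∫ y in S, F y ∂ν = 0 := by
  classical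
  obtain ⟨t, ht, hcov⟩ := hS.elim_nhds_subcover (fun x => Metric.closedBall x r)
    fun x _ => Metric.closedBall_mem_nhds x hr
  let T : Finset (Set E) := t.image fun x => Metric.closedBall x r
  have hST : S = ⋃ b ∈ T, b := by
    refine Set.Subset.antisymm (fun x hx => ?_) (Set.iUnion₂_subset fun b hb => ?_)
    · obtain ⟨z, hz, hxz⟩ := Set.mem_iUnion₂.1 (hcov hx)
      exact Set.mem_iUnion₂.2 ⟨_, Finset.mem_image_of_mem _ hz, hxz⟩
    · obtain ⟨z, hz, rfl⟩ := Finset.mem_image.1 hb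
      exact hSr z (ht z hz)
  have hTmem (b : Set E) (hb : b ∈ T) : ∃ x ∈ S, b = Metric.closedBall x r := by
    obtain ⟨z, hz, rfl⟩ := Finset.mem_image.1 hb
    exact ⟨z, ht z hz, rfl⟩
  have hint := integral_biUnion_finset (μ := ν) (f := F) T (s := fun b => b) ?_ ?_ ?_
  · rw [hST, hint]
    refine Finset.sum_eq_zero fun b hb => ?_
    obtain ⟨x, hx, rfl⟩ := hTmem b hb
    exact hF x hx
  · intro b hb
    obtain ⟨x, hx, rfl⟩ := hTmem b hb
    exact Metric.isClosed_closedBall.measurableSet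
  · intro b hb b' hb' hne
    obtain ⟨x, hx, rfl⟩ := hTmem b hb
    obtain ⟨x', hx', rfl⟩ := hTmem b' hb'
    exact (IsUltrametricDist.closedBall_eq_or_disjoint x x' r).resolve_left hne
  · intro b hb
    refine hFi.mono_set ?_
    obtain ⟨x, hx, rfl⟩ := hTmem b hb
    exact hSr x hx

/-- If the integrals of `F` vanish over all balls of radius `r` that are not contained in a larger
ball `B ⊆ S`, the integral of `F` over `S` localizes to `B`. -/
theorem setIntegral_eq_setIntegral_ball (ν : Measure E) {F : E → ℂ} {S : Set E} (hS : IsCompact S) {x₀ : E}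
    {r ρ : ℝ} (hr : 0 < r) (hrρ : r < ρ) (hFi : IntegrableOn F S ν)
    (hSr : ∀ x ∈ S, Metric.closedBall x r ⊆ S) (hB : Metric.ball x₀ ρ ⊆ S)
    (hF : ∀ x ∈ S, ρ ≤ ‖x - x₀‖ → ∫ y in Metric.closedBall x r, F y ∂ν = 0) :
    ∫ y in S, F y ∂ν = ∫ y in Metric.ball x₀ ρ, F y ∂ν := by
  have hd : ∀ x, x ∈ S \ Metric.ball x₀ ρ ↔ x ∈ S ∧ ρ ≤ ‖x - x₀‖ := fun x => by
    rw [Set.mem_sdiff, mem_ball_iff_norm, not_lt]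
  have h0 : ∫ y in S \ Metric.ball x₀ ρ, F y ∂ν = 0 := by
    refine setIntegral_eq_zero_of_closedBall ν (hS.diff Metric.isOpen_ball) hr
      (hFi.mono_set Set.sdiff_subset) (fun x hx y hy => ?_) fun x hx => ?_
    · rw [hd] at hx ⊢
      refine ⟨hSr x hx.1 hy, ?_⟩
      rw [mem_closedBall_iff_norm'] at hy
      by_contra! h
      have := (IsUltrametricDist.norm_add_le_max (x - y) (y - x₀)).trans_lt
        (max_lt (hy.trans_lt hrρ) h)
      rw [sub_add_sub_cancel] at this
      exact this.not_ge hx.2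
    · rw [hd] at hx
      exact hF x hx.1 hx.2
  rw [setIntegral_sdiff Metric.isOpen_ball.measurableSet hFi hB, sub_eq_zero] at h0
  exact h0

end Vanishing

/-! ### Oscillating integrals over balls -/

section Character

variable {K : Type*} [NontriviallyNormedField K] [IsUltrametricDist K] {Ψ : AddChar K ℂ}

theorem addChar_eq_of_norm_sub_lt_one
    (hΨ : ∀ x ∈ IsLocalRing.maximalIdeal (integers K), Ψ (x : K) = 1) {a b : K}
    (h : ‖a - b‖ < 1) : Ψ a = Ψ b := by
  have h1 : Ψ (a - b) = 1 := hΨ ⟨a - b, h.le⟩ (mem_maximalIdeal_iff.2 h)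
  rw [← sub_add_cancel a b, AddChar.map_add_eq_mul, h1, one_mul]

theorem continuous_addChar
    (hΨ : ∀ x ∈ IsLocalRing.maximalIdeal (integers K), Ψ (x : K) = 1) : Continuous Ψ := by
  refine continuous_iff_continuousAt.2 fun x => ?_
  refine (continuousAt_const (y := Ψ x)).congr ?_
  filter_upwards [Metric.ball_mem_nhds x one_pos] with y hy
  rw [mem_ball_iff_norm'] at hy
  exact addChar_eq_of_norm_sub_lt_one hΨ hy

/-- If a translation preserving a ball changes the phase `g` by a constant `w` up to elements on
which `Ψ` is trivial, and `Ψ w ≠ 1`, then the oscillating integral over the ball vanishes. -/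
theorem setIntegral_addChar_closedBall_eq_zero
    (hΨ : ∀ x ∈ IsLocalRing.maximalIdeal (integers K), Ψ (x : K) = 1)
    {E : Type*} [NormedAddCommGroup E] [IsUltrametricDist E] [MeasurableSpace E]
    [BorelSpace E] (ν : Measure E) [ν.IsAddLeftInvariant] {g : E → K} {x z : E} {r : ℝ}
    (hz : ‖z‖ ≤ r) {w : K} (hw : Ψ w ≠ 1)
    (h : ∀ y ∈ Metric.closedBall x r, ‖g (z + y) - g y - w‖ < 1) :
    ∫ y in Metric.closedBall x r, Ψ (g y) ∂ν = 0 := by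
  refine setIntegral_closedBall_eq_zero ν hz hw fun y hy => ?_
  rw [← AddChar.map_add_eq_mul]
  refine addChar_eq_of_norm_sub_lt_one hΨ ?_
  have := h y hy
  rwa [sub_sub, add_comm (g y)] at this

theorem norm_dotProduct_le {n : ℕ} (u v : Fin n → K) : ‖u ⬝ᵥ v‖ ≤ ‖u‖ * ‖v‖ := by
  rw [dotProduct]
  refine IsUltrametricDist.norm_sum_le_of_forall_le_of_nonneg (by positivity) fun i _ => ?_
  rw [norm_mul]
  exact mul_le_mul (norm_le_pi_norm u i) (norm_le_pi_norm v i) (norm_nonneg _) (norm_nonneg _)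

theorem exists_le_norm_of_ord_le {ϖ : integers K} (hϖ : IsUniformizer ϖ) (C : ℝ) :
    ∃ N : ℤ, ∀ t : K, ord ϖ t ≤ (N : WithTop ℤ) → C ≤ ‖t‖ := by
  obtain ⟨k, hk⟩ := pow_unbounded_of_one_lt C ((one_lt_inv₀ hϖ.norm_pos).2 hϖ.norm_lt_one)
  refine ⟨-k, fun t ht => ?_⟩
  obtain ⟨m, hm⟩ := WithTop.ne_top_iff_exists.1 (ht.trans_lt (WithTop.coe_lt_top _)).ne
  rw [← hm, WithTop.coe_le_coe] at ht
  rw [(ord_eq_coe_iff hϖ).1 hm.symm]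
  refine hk.le.trans ?_
  rw [inv_pow, ← zpow_natCast, ← zpow_neg]
  exact zpow_le_zpow_right_of_le_one₀ hϖ.norm_pos hϖ.norm_lt_one.le ht

/-- For a parameter of absolute value `T`, the radius `r = 1 / (2 √T)` makes the quadratic terms
invisible to a character trivial on the maximal ideal, while its linear terms are visible outside
the ball of radius `ρ = 2 / √T` and the cubic terms are invisible inside that ball. -/
theorem exists_radii {T δ : ℝ} (hδ : 0 < δ) (h64 : 64 ≤ T) (hT : 16 / δ ^ 2 ≤ T) :
    ∃ r ρ : ℝ, 0 < r ∧ r < ρ ∧ ρ < δ ∧ ρ < 1 ∧ T * r ^ 2 < 1 ∧ T * ρ * r = 1 ∧ T * ρ ^ 3 ≤ 1 := by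
  set s := √T with hs
  have hs2 : s ^ 2 = T := Real.sq_sqrt (by linarith)
  have hs8 : 8 ≤ s := Real.le_sqrt_of_sq_le (by linarith)
  have hsδ : 4 / δ ≤ s := Real.le_sqrt_of_sq_le (by rw [div_pow]; linarith)
  have hs0 : 0 < s := by linarith
  rw [div_le_iff₀ hδ] at hsδ
  refine ⟨1 / (2 * s), 2 / s, by positivity, ?_, ?_, ?_, ?_, ?_, ?_⟩
  · rw [div_lt_div_iff₀ (by positivity) hs0]
    linarith
  · rw [div_lt_iff₀ hs0]
    linarith
  · rw [div_lt_iff₀ hs0]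
    linarith
  · rw [← hs2]
    field_simp
    norm_num
  · rw [← hs2]
    field_simp
  · rw [← hs2]
    field_simp
    linarith

end Character

/-! ### Quadratic phases -/

section Quadratic

variable {K : Type*} [NontriviallyNormedField K] [IsUltrametricDist K] [ProperSpace K]
  [MeasurableSpace K] [BorelSpace K] {Ψ : AddChar K ℂ} {ϖ : integers K}

/-- One-dimensional quadratic oscillating integrals localize to small balls about `0`. -/
theorem setIntegral_disc_eq_ball (hϖ : IsUniformizer ϖ) (h2 : IsUnit (2 : integers K))
    (μ : Measure K) [μ.IsAddHaarMeasure] (hΨ_nontriv : ∃ x : integers K, Ψ (x : K) ≠ 1)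
    (hΨ : ∀ x ∈ IsLocalRing.maximalIdeal (integers K), Ψ (x : K) = 1) (a : (integers K)ˣ)
    {t : K} {r ρ : ℝ} (hr : 0 < r) (hrρ : r < ρ) (hρ1 : ρ < 1) (hq : ‖t‖ * r ^ 2 < 1)
    (hl : ‖t‖ * ρ * r = 1) :
    ∫ u in disc ϖ 1, Ψ (t * ((a : integers K) : K) * u ^ 2) ∂μ =
      ∫ u in Metric.ball 0 ρ, Ψ (t * ((a : integers K) : K) * u ^ 2) ∂μ := by
  have hdisc : disc ϖ 1 = Metric.ball (0 : K) 1 := by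
    ext u
    rw [mem_disc_one hϖ, mem_ball_zero_iff]
  have ha : ‖((a : integers K) : K)‖ = 1 := isUnit_iff_norm_eq_one.1 a.isUnit
  have h2' : ‖(2 : K)‖ = 1 := isUnit_iff_norm_eq_one.1 h2
  have hc : IsCompact (Metric.ball (0 : K) 1) :=
    (isCompact_closedBall 0 1).of_isClosed_subset (IsUltrametricDist.isClosed_ball _ _)
      Metric.ball_subset_closedBall
  have hcont : Continuous fun u : K => Ψ (t * ((a : integers K) : K) * u ^ 2) :=
    (continuous_addChar hΨ).comp (by fun_prop)
  obtain ⟨w, hw⟩ := hΨ_nontriv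
  rw [hdisc]
  refine setIntegral_eq_setIntegral_ball μ hc hr hrρ (hcont.continuousOn.integrableOn_compact hc)
    (fun x hx y hy => ?_) (Metric.ball_subset_ball hρ1.le) fun x _ hxρ => ?_
  · rw [mem_ball_zero_iff] at hx ⊢
    rw [mem_closedBall_iff_norm] at hy
    rw [← sub_add_cancel y x]
    exact (IsUltrametricDist.norm_add_le_max _ _).trans_lt
      (max_lt (hy.trans_lt (hrρ.trans hρ1)) hx)
  · rw [sub_zero] at hxρ
    have hT : 0 < ‖t‖ := by
      by_contra! h
      nlinarith [norm_nonneg t, mul_pos (hr.trans hrρ) hr]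
    have hx0 : x ≠ 0 := norm_pos_iff.1 ((hr.trans hrρ).trans_le hxρ)
    set D : K := 2 * t * a * x with hD
    have hDn : ‖D‖ = ‖t‖ * ‖x‖ := by rw [hD, norm_mul, norm_mul, norm_mul, h2', ha]; ring
    have hD0 : D ≠ 0 := norm_pos_iff.1 (by rw [hDn]; exact mul_pos hT (norm_pos_iff.2 hx0))
    have hz : ‖(w : K) / D‖ ≤ r := by
      rw [norm_div, div_le_iff₀ (norm_pos_iff.2 hD0), hDn]
      refine (norm_coe_le_one w).trans ?_
      rw [← hl, mul_comm r, mul_assoc, mul_assoc]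
      gcongr
    refine setIntegral_addChar_closedBall_eq_zero hΨ μ hz hw fun y hy => ?_
    rw [mem_closedBall_iff_norm] at hy
    set z : K := w / D with hzdef
    have hwz : (w : K) = 2 * t * a * x * z := by rw [hzdef, ← hD, mul_div_cancel₀ _ hD0]
    have e : t * a * (z + y) ^ 2 - t * a * y ^ 2 - w =
        t * (a * ((z + 2 * (y - x)) * z)) := by
      rw [hwz]; ring
    rw [e, norm_mul, norm_mul, ha, one_mul, norm_mul]
    have h1 : ‖z + 2 * (y - x)‖ ≤ r :=
      (IsUltrametricDist.norm_add_le_max _ _).trans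
        (max_le hz (by rw [norm_mul, h2', one_mul]; exact hy))
    calc ‖t‖ * (‖z + 2 * (y - x)‖ * ‖z‖) ≤ ‖t‖ * (r * r) := by gcongr
      _ < 1 := by rwa [← pow_two]

/-- The oscillating integral of a unimodular quadratic form over a ball is a product of
one-dimensional ones. -/
theorem setIntegral_quadratic_eq_prod (μ : Measure K) [μ.IsAddHaarMeasure] {n : ℕ}
    {P : Matrix (Fin n) (Fin n) (integers K)} (hP : IsUnit P.det) (a : Fin n → (integers K)ˣ)
    (t : K) {ρ : ℝ} (hρ : 0 < ρ) :
    ∫ y in Metric.ball (0 : Fin n → K) ρ, Ψ (t * (y ⬝ᵥ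
      ((P.transpose * Matrix.diagonal (fun i => (a i : integers K)) * P).map
        (algebraMap (integers K) K)).mulVec y)) ∂(Measure.pi fun _ : Fin n => μ) =
      ∏ i, ∫ u in Metric.ball 0 ρ, Ψ (t * ((a i : integers K) : K) * u ^ 2) ∂μ := by
  have hquad (y : Fin n → K) : t * (y ⬝ᵥ
      ((P.transpose * Matrix.diagonal (fun i => (a i : integers K)) * P).map
        (algebraMap (integers K) K)).mulVec y) =
      ∑ i, t * ((a i : integers K) : K) * unimodularEquiv P hP y i ^ 2 := by
    rw [unimodularEquiv_apply, Matrix.map_mul, Matrix.map_mul, ← Matrix.mulVec_mulVec,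
      ← Matrix.mulVec_mulVec, Matrix.dotProduct_mulVec, Matrix.transpose_map,
      Matrix.vecMul_transpose, Matrix.diagonal_map (map_zero _), dotProduct, Finset.mul_sum]
    refine Finset.sum_congr rfl fun i _ => ?_
    rw [Matrix.mulVec_diagonal]
    change t * (_ * (((a i : integers K) : K) * _)) = _
    ring
  have hpre : unimodularEquiv P hP ⁻¹' Metric.ball 0 ρ = Metric.ball 0 ρ := by
    ext y
    simp [norm_unimodularEquiv]
  have h := (measurePreserving_unimodularEquiv (Measure.pi fun _ : Fin n => μ) P
    hP).setIntegral_preimage_emb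
      (unimodularEquiv P hP).toHomeomorph.measurableEmbedding
      (fun y => ∏ i, Ψ (t * ((a i : integers K) : K) * y i ^ 2)) (Metric.ball 0 ρ)
  rw [hpre] at h
  have hsum (v : Fin n → K) : Ψ (∑ i, v i) = ∏ i, Ψ (v i) :=
    map_prod Ψ.toMonoidHom (fun i => Multiplicative.ofAdd (v i)) Finset.univ
  simp only [hquad, hsum]
  rw [h, ball_pi _ hρ, Measure.restrict_pi_pi]
  exact integral_fintype_prod_eq_prod (𝕜 := ℂ)
    (fun i u => Ψ (t * ((a i : integers K) : K) * u ^ 2))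

end Quadratic

/-! ### Localization at a nondegenerate critical point -/

section Localization

variable {K : Type*} [NontriviallyNormedField K] [IsUltrametricDist K] [LocallyCompactSpace K]
  {n : ℕ} {Ω : Set (Fin n → K)} {f : (Fin n → K) → K}

/-- Near a critical point with unimodular Hessian the gradient grows linearly, and elsewhere on a
compact set without further critical points it is bounded below. -/
theorem exists_norm_grad_ge (hΩ_open : IsOpen Ω) (hΩ_int : ∀ x ∈ Ω, ∀ i, x i ∈ integers K)
    (hf : GloballyAnalyticOn f Ω) {x₀ : Fin n → K} (hx₀ : IsCriticalPointOn f Ω x₀)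
    (hx₀_unique : ∀ x, IsCriticalPointOn f Ω x → x = x₀)
    (hH : ∀ y, ‖(hessian f x₀).mulVec y‖ = ‖y‖) {S : Set (Fin n → K)} (hS : IsCompact S)
    (hSΩ : S ⊆ Ω) :
    ∃ ε > 0, ∀ ρ ≤ ε, ∀ x ∈ S, ρ ≤ ‖x - x₀‖ → ρ ≤ ‖grad f x‖ := by
  obtain ⟨-, -, hg1, hg2, -⟩ := hf.taylor hΩ_open hΩ_int
  have hnear (x : Fin n → K) (hx : x ∈ Ω) (h1 : ‖x - x₀‖ < 1) : ‖x - x₀‖ ≤ ‖grad f x‖ := by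
    rcases eq_or_ne x x₀ with rfl | hne
    · simp
    have hpos : 0 < ‖x - x₀‖ := norm_pos_iff.2 (sub_ne_zero.2 hne)
    have h := hg2 x₀ (x - x₀) hx₀.1 (by rwa [add_sub_cancel])
    rw [add_sub_cancel, hx₀.2, sub_zero] at h
    by_contra! hlt
    have h3 := IsUltrametricDist.norm_add_le_max (grad f x)
      (-(grad f x - (hessian f x₀).mulVec (x - x₀)))
    rw [norm_neg, ← sub_eq_add_neg, sub_sub_cancel, hH] at h3
    have h4 : ‖x - x₀‖ ^ 2 < ‖x - x₀‖ := by nlinarith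
    exact (h3.trans_lt (max_lt hlt (h.trans_lt h4))).false
  have hcont : ContinuousOn (grad f) Ω := by
    refine (LipschitzOnWith.of_dist_le_mul (K := 1) fun x hx y hy => ?_).continuousOn
    rw [NNReal.coe_one, one_mul, dist_eq_norm, dist_eq_norm]
    have := hg1 y (x - y) hy (by rwa [add_sub_cancel])
    rwa [add_sub_cancel] at this
  have hS' : IsCompact (S \ Metric.ball x₀ 1) := hS.diff Metric.isOpen_ball
  obtain ⟨ε, hε, hε'⟩ : ∃ ε > 0, ∀ x ∈ S \ Metric.ball x₀ 1, ε ≤ ‖grad f x‖ := by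
    refine hS'.exists_forall_le' (hcont.mono (Set.sdiff_subset.trans hSΩ)).norm fun x hx => ?_
    refine norm_pos_iff.2 fun h0 => hx.2 ?_
    rw [hx₀_unique x ⟨hSΩ hx.1, h0⟩]
    exact Metric.mem_ball_self one_pos
  refine ⟨ε, hε, fun ρ hρ x hx hρx => ?_⟩
  by_cases h1 : ‖x - x₀‖ < 1
  · exact hρx.trans (hnear x (hSΩ hx) h1)
  · exact hρ.trans (hε' x ⟨hx, by rwa [mem_ball_iff_norm]⟩)

variable [MeasurableSpace K] [BorelSpace K] {Ψ : AddChar K ℂ}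

/-- Over balls on which the gradient is large the oscillating integral vanishes: translation by a
small multiple of a coordinate vector changes the phase by an essentially constant amount. -/
theorem setIntegral_closedBall_eq_zero_of_grad (hΩ_open : IsOpen Ω)
    (hΩ_int : ∀ x ∈ Ω, ∀ i, x i ∈ integers K) (hf : GloballyAnalyticOn f Ω)
    (ν : Measure (Fin n → K)) [ν.IsAddLeftInvariant]
    (hΨ_nontriv : ∃ x : integers K, Ψ (x : K) ≠ 1)
    (hΨ : ∀ x ∈ IsLocalRing.maximalIdeal (integers K), Ψ (x : K) = 1)
    {t : K} {r ρ : ℝ} (hr : 0 < r) (hρ : 0 < ρ) (hq : ‖t‖ * r ^ 2 < 1) (hl : ‖t‖ * ρ * r = 1)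
    {x : Fin n → K} (hx : Metric.closedBall x r ⊆ Ω) (hg : ρ ≤ ‖grad f x‖) :
    ∫ y in Metric.closedBall x r, Ψ (t * f y) ∂ν = 0 := by
  have : ProperSpace K := ProperSpace.of_locallyCompactSpace K
  obtain ⟨-, hf2, hg1, -⟩ := hf.taylor hΩ_open hΩ_int
  obtain ⟨w, hw⟩ := hΨ_nontriv
  obtain ⟨i, hi⟩ : ∃ i, ρ ≤ ‖grad f x i‖ := by
    by_contra! h
    exact hg.not_gt ((pi_norm_lt_iff hρ).2 h)
  have hT : 0 < ‖t‖ := by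
    by_contra! h
    nlinarith [norm_nonneg t, mul_pos hρ hr]
  set D : K := t * grad f x i with hD
  have hDn : ‖D‖ = ‖t‖ * ‖grad f x i‖ := norm_mul _ _
  have hD0 : D ≠ 0 := norm_pos_iff.1 (by rw [hDn]; exact mul_pos hT (hρ.trans_le hi))
  set z : Fin n → K := Pi.single i ((w : K) / D) with hzdef
  have hz : ‖z‖ ≤ r := by
    rw [hzdef, Pi.norm_single, norm_div, div_le_iff₀ (norm_pos_iff.2 hD0), hDn]
    refine (norm_coe_le_one w).trans ?_
    rw [← hl, mul_comm r, mul_assoc, mul_assoc]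
    gcongr
  have hwz : (w : K) = t * (grad f x ⬝ᵥ z) := by
    rw [hzdef, dotProduct_single, ← mul_assoc, ← hD, mul_div_cancel₀ _ hD0]
  refine setIntegral_addChar_closedBall_eq_zero hΨ ν hz hw fun y hy => ?_
  have hxΩ : x ∈ Ω := hx (Metric.mem_closedBall_self hr.le)
  have hyΩ : y ∈ Ω := hx hy
  rw [mem_closedBall_iff_norm] at hy
  have hyz : y + z ∈ Ω := hx (by
    rw [mem_closedBall_iff_norm, add_sub_right_comm]
    exact (IsUltrametricDist.norm_add_le_max _ _).trans (max_le hy hz))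
  have e : t * f (z + y) - t * f y - w =
      t * ((f (y + z) - f y - grad f y ⬝ᵥ z) + (grad f y - grad f x) ⬝ᵥ z) := by
    rw [hwz, sub_dotProduct, add_comm z y]
    ring
  have h1 : ‖f (y + z) - f y - grad f y ⬝ᵥ z‖ ≤ r ^ 2 :=
    (hf2 y z hyΩ hyz).trans (by gcongr)
  have h2 : ‖(grad f y - grad f x) ⬝ᵥ z‖ ≤ r ^ 2 := by
    refine (norm_dotProduct_le _ _).trans ?_
    have := hg1 x (y - x) hxΩ (by rwa [add_sub_cancel])
    rw [add_sub_cancel] at this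
    rw [pow_two]
    exact mul_le_mul (this.trans hy) hz (norm_nonneg _) hr.le
  rw [e, norm_mul]
  refine lt_of_le_of_lt ?_ hq
  gcongr
  exact (IsUltrametricDist.norm_add_le_max _ _).trans (max_le h1 h2)

/-- On a ball about the critical point so small that the cubic Taylor remainder is invisible to
`Ψ`, the phase may be replaced by half of the Hessian form. -/
theorem setIntegral_ball_eq_quadratic (hΩ_open : IsOpen Ω)
    (hΩ_int : ∀ x ∈ Ω, ∀ i, x i ∈ integers K) (hf : GloballyAnalyticOn f Ω)
    (ν : Measure (Fin n → K)) [ν.IsAddLeftInvariant]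
    (hΨ : ∀ x ∈ IsLocalRing.maximalIdeal (integers K), Ψ (x : K) = 1)
    (h2 : IsUnit (2 : integers K)) {x₀ : Fin n → K} (hx₀ : IsCriticalPointOn f Ω x₀)
    {A : Matrix (Fin n) (Fin n) K} (hA : hessian f x₀ = (2 : K) • A)
    {t : K} {ρ : ℝ} (hc : ‖t‖ * ρ ^ 3 ≤ 1) (hB : Metric.ball x₀ ρ ⊆ Ω) :
    ∫ x in Metric.ball x₀ ρ, Ψ (t * f x) ∂ν =
      Ψ (t * f x₀) * ∫ y in Metric.ball (0 : Fin n → K) ρ, Ψ (t * (y ⬝ᵥ A.mulVec y)) ∂ν := by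
  have : ProperSpace K := ProperSpace.of_locallyCompactSpace K
  obtain ⟨-, -, -, -, hf3, -⟩ := hf.taylor hΩ_open hΩ_int
  have h2' : ‖(2 : K)‖ = 1 := isUnit_iff_norm_eq_one.1 h2
  have hpre : (fun y => x₀ + y) ⁻¹' Metric.ball x₀ ρ = Metric.ball 0 ρ := by
    ext y
    simp
  have h := (measurePreserving_add_left ν x₀).setIntegral_preimage_emb
    (measurableEmbedding_addLeft x₀) (fun x => Ψ (t * f x)) (Metric.ball x₀ ρ)
  rw [← h, hpre, ← integral_const_mul]
  refine setIntegral_congr_fun Metric.isOpen_ball.measurableSet fun y hy => ?_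
  have hyΩ : x₀ + y ∈ Ω := hB (by simpa using hy)
  rw [mem_ball_zero_iff] at hy
  have h3 := hf3 x₀ y hx₀.1 hyΩ
  have e : (2 : K) * (f (x₀ + y) - f x₀ - grad f x₀ ⬝ᵥ y) - y ⬝ᵥ (hessian f x₀).mulVec y =
      2 * (f (x₀ + y) - (f x₀ + y ⬝ᵥ A.mulVec y)) := by
    rw [hA, hx₀.2, zero_dotProduct, Matrix.smul_mulVec, dotProduct_smul, smul_eq_mul]
    ring
  rw [e, norm_mul, h2', one_mul] at h3
  change Ψ (t * f (x₀ + y)) = Ψ (t * f x₀) * Ψ (t * (y ⬝ᵥ A.mulVec y))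
  rw [← AddChar.map_add_eq_mul, ← mul_add]
  rcases eq_or_ne t 0 with rfl | ht
  · simp
  refine addChar_eq_of_norm_sub_lt_one hΨ ?_
  rw [← mul_sub, norm_mul]
  refine lt_of_lt_of_le ?_ hc
  exact mul_lt_mul_of_pos_left (h3.trans_lt (by gcongr)) (norm_pos_iff.2 ht)

end Localization

/-! ### Schwartz-Bruhat functions -/

section SchwartzBruhat

variable {K : Type*} [NontriviallyNormedField K] {n : ℕ} {Ω : Set (Fin n → K)}

theorem IsSchwartzBruhatOn.exists_ball_const {φ : (Fin n → K) → ℂ}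
    (hφ : IsSchwartzBruhatOn φ Ω) :
    ∃ δ > 0, ∀ x ∈ tsupport φ, ∀ y, ‖y - x‖ < δ → φ y = φ x := by
  obtain ⟨δ, hδ, h⟩ := lebesgue_number_lemma_of_metric (c := fun v : ℂ => φ ⁻¹' {v})
    hφ.hasCompactSupport (fun v => hφ.isLocallyConstant.isOpen_fiber v)
    (fun x _ => Set.mem_iUnion.2 ⟨φ x, rfl⟩)
  refine ⟨δ, hδ, fun x hx y hy => ?_⟩
  obtain ⟨v, hv⟩ := h x hx
  have h1 : φ y = v := hv (mem_ball_iff_norm.2 hy)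
  have h2 : φ x = v := hv (Metric.mem_ball_self hδ)
  rw [h1, h2]

theorem IsSchwartzBruhatOn.mem_tsupport_iff {φ : (Fin n → K) → ℂ}
    (hφ : IsSchwartzBruhatOn φ Ω) {x : Fin n → K} : x ∈ tsupport φ ↔ φ x ≠ 0 := by
  have hc : IsClosed (Function.support φ) :=
    isOpen_compl_iff.1 (by
      rw [Function.compl_support]
      exact hφ.isLocallyConstant.isOpen_fiber 0)
  rw [tsupport, hc.closure_eq, Function.mem_support]

end SchwartzBruhat

/-! ### The Hessian as an integral matrix -/

section Hessian

variable {K : Type*} [NontriviallyNormedField K] [IsUltrametricDist K] {n : ℕ}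

/-- The Hessian at a point that is nondegenerate modulo `ϖ` is a unimodular matrix over `𝒪`. -/
theorem exists_integral_hessian {ϖ : integers K} (hϖ : IsUniformizer ϖ)
    {f : (Fin n → K) → K} {x₀ : Fin n → K} (hint : ∀ i j, hessian f x₀ i j ∈ integers K)
    (hsymm : (hessian f x₀).IsSymm) (hnd : IsNondegenerateMod ϖ f x₀) :
    ∃ H : Matrix (Fin n) (Fin n) (integers K), hessian f x₀ = H.map (algebraMap (integers K) K) ∧
      H.IsSymm ∧ IsUnit H.det := by
  let H : Matrix (Fin n) (Fin n) (integers K) := Matrix.of fun i j => ⟨_, hint i j⟩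
  have hH : hessian f x₀ = H.map (algebraMap (integers K) K) := rfl
  refine ⟨H, hH, ?_, ?_⟩
  · ext i j
    exact hsymm.apply i j
  · have hdet : (hessian f x₀).det = (H.det : K) := by
      rw [hH]
      exact (RingHom.map_det (algebraMap (integers K) K) H).symm
    rw [IsNondegenerateMod, mem_disc_one hϖ, hdet] at hnd
    exact isUnit_iff_norm_eq_one.2 (le_antisymm (norm_coe_le_one _) (not_lt.1 hnd))

end Hessian

end StationaryPhase

/-! ### The stationary phase formula -/

theorem theorem1p6
    {K : Type*} [NontriviallyNormedField K] [IsUltrametricDist K] [LocallyCompactSpace K]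
    [MeasurableSpace K] [BorelSpace K]
    -- the residue characteristic is not 2
    (h_char : ringChar (IsLocalRing.ResidueField (integers K)) ≠ 2)
    (ϖ : integers K) (hϖ : IsUniformizer ϖ)
    -- the Haar measure giving mass one to the valuation ring
    (μ : Measure K) [μ.IsAddHaarMeasure] (hμ : μ (integers K : Set K) = 1)
    -- the additive character, nontrivial on the valuation ring and trivial on its maximal ideal
    (Ψ : AddChar K ℂ)
    (hΨ_nontriv : ∃ x : integers K, Ψ (x : K) ≠ 1)
    (hΨ_triv : ∀ x ∈ IsLocalRing.maximalIdeal (integers K), Ψ (x : K) = 1)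
    (n : ℕ) (Ω : Set (Fin n → K)) (hΩ_open : IsOpen Ω)
    (hΩ_int : ∀ x ∈ Ω, ∀ i, x i ∈ integers K)
    (f : (Fin n → K) → K) (hf : GloballyAnalyticOn f Ω)
    -- the unique critical point
    (x₀ : Fin n → K) (hx₀ : IsCriticalPointOn f Ω x₀)
    (hx₀_unique : ∀ x, IsCriticalPointOn f Ω x → x = x₀)
    (hx₀_nondeg : IsNondegenerateMod ϖ f x₀)
    -- the second-order Taylor remainder
    (R : (Fin n → K) → (Fin n → K) → Matrix (Fin n) (Fin n) K)
    (hR : ∀ x y, x ∈ Ω → x + y ∈ Ω →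
      f (x + y) = f x + grad f x ⬝ᵥ y + Matrix.mulVec (R x y) y ⬝ᵥ y)
    (M : ℝ) (hR_bdd : ∀ x y, x ∈ Ω → x + y ∈ Ω → ∀ i j, ‖R x y i j‖ ≤ M) :
    ∃ α : ℕ, 1 ≤ α ∧ ∃ a : Fin n → (integers K)ˣ,
      ∀ φ : (Fin n → K) → ℂ, IsSchwartzBruhatOn φ Ω → x₀ ∈ tsupport φ →
        ∃ N : ℤ, ∀ t : K, ord ϖ t ≤ (N : WithTop ℤ) →
          oscIntegral μ Ψ Ω f φ t =
            Ψ (t * f x₀) * φ x₀ *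
              ∏ i, ∫ u in disc ϖ α, Ψ (t * ((a i : integers K) : K) * u ^ 2) ∂μ := by
  have : ProperSpace K := ProperSpace.of_locallyCompactSpace K
  have h2 : IsUnit (2 : integers K) := isUnit_two h_char
  obtain ⟨hf1, -, -, -, -, hint, hsymm⟩ := hf.taylor hΩ_open hΩ_int
  obtain ⟨H, hH, hHs, hHu⟩ :=
    exists_integral_hessian hϖ (hint x₀ hx₀.1) (hsymm x₀ hx₀.1) hx₀_nondeg
  -- `A` is half of the Hessian
  obtain ⟨b, hb⟩ := h2.exists_right_inv
  obtain ⟨A, hHA⟩ : ∃ A, H = (2 : integers K) • A := ⟨b • H, by rw [smul_smul, hb, one_smul]⟩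
  have hAH : A = b • H := by rw [hHA, smul_smul, mul_comm b, hb, one_smul]
  have hAs : A.IsSymm := by rw [hAH]; exact hHs.smul b
  have hAu : IsUnit A.det := by
    rw [hHA, Matrix.det_smul] at hHu
    exact isUnit_of_mul_isUnit_right hHu
  obtain ⟨P, hP, a, hPA⟩ := isUnitDiagonalizable_of_isSymm h2 hAs hAu
  have hH2 : hessian f x₀ = (2 : K) • A.map (algebraMap (integers K) K) := by
    rw [hH, hHA]
    ext i j
    rfl
  have hHnorm (y : Fin n → K) : ‖(hessian f x₀).mulVec y‖ = ‖y‖ := by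
    rw [hH]
    exact norm_unimodularEquiv H hHu y
  -- The integrals over `ϖ ^ α 𝒪` do not depend on `α` once `t` is large, so `α = 1` will do.
  refine ⟨1, le_rfl, a, fun φ hφ hx₀φ => ?_⟩
  obtain ⟨δ, hδ, hconst⟩ := hφ.exists_ball_const
  obtain ⟨ε, hε, hgrad⟩ := exists_norm_grad_ge hΩ_open hΩ_int hf hx₀ hx₀_unique hHnorm
    hφ.hasCompactSupport hφ.tsupport_subset
  have hη : 0 < min δ ε := lt_min hδ hε
  obtain ⟨N, hN⟩ := exists_le_norm_of_ord_le hϖ (max 64 (16 / min δ ε ^ 2))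
  refine ⟨N, fun t ht => ?_⟩
  have htC := hN t ht
  obtain ⟨r, ρ, hr, hrρ, hρη, hρ1, hq, hl, hc⟩ :=
    exists_radii hη ((le_max_left _ _).trans htC) ((le_max_right _ _).trans htC)
  have hρ : 0 < ρ := hr.trans hrρ
  have hρδ : ρ < δ := hρη.trans_le (min_le_left _ _)
  have hρε : ρ ≤ ε := hρη.le.trans (min_le_right _ _)
  have hmem (x : Fin n → K) (hx : x ∈ tsupport φ) (y : Fin n → K) (hy : ‖y - x‖ < δ) :
      y ∈ tsupport φ := by
    rw [hφ.mem_tsupport_iff, hconst x hx y hy]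
    exact hφ.mem_tsupport_iff.1 hx
  have hball : Metric.ball x₀ ρ ⊆ tsupport φ := fun y hy =>
    hmem x₀ hx₀φ y ((mem_ball_iff_norm.1 hy).trans hρδ)
  have hcball (x : Fin n → K) (hx : x ∈ tsupport φ) : Metric.closedBall x r ⊆ tsupport φ :=
    fun y hy => hmem x hx y ((mem_closedBall_iff_norm.1 hy).trans_lt (hrρ.trans hρδ))
  have hfcont : ContinuousOn f Ω := by
    refine (LipschitzOnWith.of_dist_le_mul (K := 1) fun x hx y hy => ?_).continuousOn
    rw [NNReal.coe_one, one_mul, dist_eq_norm, dist_eq_norm]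
    have := hf1 y (x - y) hy (by rwa [add_sub_cancel])
    rwa [add_sub_cancel] at this
  have hFcont : ContinuousOn (fun x => φ x * Ψ (t * f x)) (tsupport φ) :=
    hφ.isLocallyConstant.continuous.continuousOn.mul
      ((continuous_addChar hΨ_triv).comp_continuousOn
        (continuousOn_const.mul (hfcont.mono hφ.tsupport_subset)))
  rw [oscIntegral, setIntegral_eq_of_subset_of_forall_sdiff_eq_zero hΩ_open.measurableSet
    hφ.tsupport_subset fun x hx => by rw [image_eq_zero_of_notMem_tsupport hx.2, zero_mul],
    setIntegral_eq_setIntegral_ball _ hφ.hasCompactSupport hr hrρ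
      (hFcont.integrableOn_compact hφ.hasCompactSupport) hcball hball fun x hx hxρ => ?_]
  · rw [setIntegral_congr_fun (g := fun x => φ x₀ * Ψ (t * f x)) Metric.isOpen_ball.measurableSet
      fun x hx => by
        rw [hconst x₀ hx₀φ x ((mem_ball_iff_norm.1 hx).trans hρδ)],
      integral_const_mul, setIntegral_ball_eq_quadratic hΩ_open hΩ_int hf _ hΨ_triv h2 hx₀ hH2 hc
        (hball.trans hφ.tsupport_subset), hPA, setIntegral_quadratic_eq_prod μ hP a t hρ]
    rw [Finset.prod_congr rfl fun i _ =>
      setIntegral_disc_eq_ball hϖ h2 μ hΨ_nontriv hΨ_triv (a i) hr hrρ hρ1 hq hl]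
    ring
  · rw [setIntegral_congr_fun (g := fun y => φ x * Ψ (t * f y))
      Metric.isClosed_closedBall.measurableSet fun y hy => by
        rw [hconst x hx y ((mem_closedBall_iff_norm.1 hy).trans_lt (hrρ.trans hρδ))],
      integral_const_mul, setIntegral_closedBall_eq_zero_of_grad hΩ_open hΩ_int hf _ hΨ_nontriv
        hΨ_triv hr hρ hq hl ((hcball x hx).trans hφ.tsupport_subset) (hgrad ρ hρε x hx hxρ),
      mul_zero]
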